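/- A measurable flow on a standard Borel space $X$ is a jointly measurable action $\mathcal S=(S_t)_{t\in\mathbb R}$ of the group $\mathbb R$ on $X$. It is ergodic with respect to a $\sigma$-finite measure $\mu$ if it preserves $\mu$ and every measurable set $B$ with $\mu(S_t^{-1}B\,\triangle\,B)=0$ for all $t\in\mathbb R$ is null or conull. Let $\mu$ be a probability measure on the $\sigma$-algebra $\mathcal B$ of $X$. A factor of $\mathcal S$ is a sub-$\sigma$-algebra $\mathcal A\subset\mathcal B$ with $S_t^{-1}A\in\mathcal A$ for all $A\in\mathcal A$ and $t\in\mathbb R$; it is non-trivial if $0<\mu(A)<1$ for some $A\in\mathcal A$. The flow $\mathcal S$ is a finite extension of the factor $\mathcal A$ if almost every fibre measure of the disintegration of $\mu$ over $\mathcal A$ is carried by a finite set. The flow $\mathcal S$ is partially rigid if there are a sequence $t_n\to+\infty$ and a number $0<u\le 1$ such that $\liminf_{n\to\infty}\mu(A\cap S_{-t_n}A)\ge u\,\mu(A)$ for every $A\in\mathcal B$. It is mildly mixing if, for every ergodic measurable flow $\mathcal T=(T_t)_{t\in\mathbb R}$ preserving a $\sigma$-finite measure $\nu$ on a standard Borel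 space $Y$, where $\nu$ is either finite, or infinite and not of type I (that is, not carried by a single orbit of $\mathcal T$), the product flow $(S_t\times T_t)_{t\in\mathbb R}$ on $(X\times Y,\mu\otimes\nu)$ is ergodic. Lemma. Let $\mathcal S$ be an ergodic measurable flow on a standard Borel probability space $(X,\mathcal B,\mu)$ which is a finite extension of each of its non-trivial factors. If $\mathcal S$ is not partially rigid, then $\mathcal S$ is mildly mixing. -/

import Mathlib

open MeasureTheory ProbabilityTheory Filter
open scoped ENNReal

/-!
A measurable flow on `X` is an action of the additive group `ℝ` on `X`, written `t +ᵥ x`, such that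
`(t, x) ↦ t +ᵥ x` is jointly measurable (`AddAction ℝ X` together with `MeasurableVAdd₂ ℝ X`).
It is ergodic for `μ` (`ErgodicVAdd ℝ X μ`) if it preserves `μ` and every measurable set that is
invariant modulo `μ` under each time-`t` map is null or conull.
-/

universe u v

namespace ErgodicFlow

/-- A factor of a flow on `(X, mX)`: a sub-σ-algebra `m` of the σ-algebra `mX` that is invariant
under the flow, i.e. preimages of sets of `m` under the time-`t` maps are again in `m`. -/
structure IsFactor {X : Type u} [AddAction ℝ X] (m mX : MeasurableSpace X) : Prop where
  le : m ≤ mX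
  invariant : ∀ (t : ℝ) (A : Set X), MeasurableSet[m] A →
    MeasurableSet[m] ((fun x : X => t +ᵥ x) ⁻¹' A)

/-- A sub-σ-algebra is non-trivial for `μ` if it contains a set that is neither null nor conull. -/
def IsNontrivial {X : Type u} (m : MeasurableSpace X) {mX : MeasurableSpace X} (μ : Measure X) :
    Prop :=
  ∃ A : Set X, MeasurableSet[m] A ∧ μ A ≠ 0 ∧ μ Aᶜ ≠ 0

/-- `(X, μ)` is a finite extension of its sub-σ-algebra `m`: almost every fibre measure of the
disintegration of `μ` over `m` is carried by a finite set. -/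
def IsFiniteExtension {X : Type u} (m : MeasurableSpace X) {mX : MeasurableSpace X}
    [StandardBorelSpace X] (μ : Measure X) [IsFiniteMeasure μ] : Prop :=
  ∀ᵐ x ∂μ, ∃ F : Set X, F.Finite ∧ condExpKernel μ m x Fᶜ = 0

/-- A flow is partially rigid if, along some sequence of times `t n → +∞` and for some `0 < u ≤ 1`,
`liminf μ (A ∩ S_{-t n} A) ≥ u * μ A` for every measurable set `A`. -/
def IsPartiallyRigid {X : Type u} [MeasurableSpace X] [AddAction ℝ X] (μ : Measure X) : Prop :=
  ∃ t : ℕ → ℝ, Tendsto t atTop atTop ∧ ∃ c : ℝ≥0∞, 0 < c ∧ c ≤ 1 ∧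
    ∀ A : Set X, MeasurableSet A →
      c * μ A ≤ liminf (fun n => μ (A ∩ (fun x : X => t n +ᵥ x) ⁻¹' A)) atTop

/-- An (ergodic) flow is of type I if its measure is carried by a single orbit. -/
def IsTypeI {Y : Type v} [MeasurableSpace Y] [AddAction ℝ Y] (ν : Measure Y) : Prop :=
  ∃ y : Y, ν (AddAction.orbit ℝ y)ᶜ = 0

/-- A flow on `(X, μ)` is mildly mixing if its Cartesian product with every ergodic
measure-preserving flow on a σ-finite standard measure space, whose measure is finite, or infinite
and not of type I, is ergodic. The product flow is `t +ᵥ (x, y) = (t +ᵥ x, t +ᵥ y)`. -/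
def IsMildlyMixing {X : Type u} [MeasurableSpace X] [AddAction ℝ X] (μ : Measure X) : Prop :=
  ∀ (Y : Type v) [MeasurableSpace Y] [StandardBorelSpace Y] [AddAction ℝ Y] [MeasurableVAdd₂ ℝ Y]
    (ν : Measure Y) [SigmaFinite ν] [ErgodicVAdd ℝ Y ν],
    (IsFiniteMeasure ν ∨ ¬ IsTypeI ν) → ErgodicVAdd ℝ (X × Y) (μ.prod ν)

end ErgodicFlow

/-! Let B be an invariant set of the product flow. After a null modification it is strictly
invariant, so its fibres satisfy A_{t+y} = S_t A_y. By ergodicity of ν, almost all fibres are null,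
or almost all are conull, or almost all are non-trivial; the last case has to be excluded.

Some fibre would then be recurrent (`exists_isRecurrentSet_of_equivariant`). Otherwise the orbit of
a typical fibre is a closed, injectively parametrized line in the measure algebra, almost every A_y
lies on it by ergodicity, and its parameter is an equivariant map Y → ℝ. Its image of a finite ν
would be a finite translation-invariant measure on ℝ; for infinite ν it would show type I
(`false_of_ae_equivariant`).

A non-trivial recurrent set forces partial rigidity (`isPartiallyRigid_of_isRecurrentSet`). The sets
rigid along its return times t_n form a non-trivial factor, so X is finite over it and, on some C of
positive measure, every set is the trace of a factor set. By pigeonhole, differences τ of the t_n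
keep μ(C ∩ S_{-τ}C) bounded below; a weak limit yields partial rigidity on part of C, and ergodicity
spreads it to X. -/

namespace ErgodicFlow

open Set Topology
open scoped symmDiff

/-! ### The action on the measure algebra and its continuity -/

/-- The preimage of a set under the time-`t` map of a flow. -/
abbrev shift {X : Type*} [VAdd ℝ X] (t : ℝ) (A : Set X) : Set X := (fun x : X => t +ᵥ x) ⁻¹' A

theorem shift_shift {X : Type*} [AddAction ℝ X] (s t : ℝ) (A : Set X) : shift s (shift t A) = shift (t + s) A := by
  ext x
  simp [shift, add_vadd]

theorem shift_zero {X : Type*} [AddAction ℝ X] (A : Set X) : shift 0 A = A := by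
  ext x
  simp [shift]

theorem exists_countable_dense_sets {X : Type*} [MeasurableSpace X]
    [MeasurableSpace.CountablyGenerated X] (μ : Measure X) [IsFiniteMeasure μ] :
    ∃ E : ℕ → Set X, (∀ n, MeasurableSet (E n)) ∧
      ∀ A, MeasurableSet A → ∀ ε > 0, ∃ n, μ.real (A ∆ E n) < ε := by
  obtain ⟨𝒜, hc, hd⟩ := exists_countable_measureDense (μ := μ)
  obtain ⟨E, hE⟩ := hc.exists_eq_range hd.nonempty
  refine ⟨E, fun n => hd.measurable _ (hE ▸ mem_range_self n), fun A hA ε hε => ?_⟩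
  obtain ⟨t, ht, h⟩ := hd.approx A hA (measure_ne_top _ _) ε hε
  rw [hE] at ht
  obtain ⟨n, rfl⟩ := ht
  exact ⟨n, ENNReal.toReal_lt_of_lt_ofReal h⟩

theorem measure_shift {X : Type*} [MeasurableSpace X] [AddAction ℝ X] (μ : Measure X)
    [VAddInvariantMeasure ℝ X μ] (t : ℝ) {A : Set X} (hA : MeasurableSet A) :
    μ (shift t A) = μ A :=
  VAddInvariantMeasure.measure_preimage_vadd t hA

theorem measureReal_shift {X : Type*} [MeasurableSpace X] [AddAction ℝ X] (μ : Measure X)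
    [VAddInvariantMeasure ℝ X μ] (t : ℝ) {A : Set X} (hA : MeasurableSet A) :
    μ.real (shift t A) = μ.real A := by
  rw [measureReal_def, measureReal_def, measure_shift μ t hA]

section Shift

variable {X : Type*} [MeasurableSpace X] [AddAction ℝ X] [MeasurableVAdd₂ ℝ X]

theorem measurableSet_shift (t : ℝ) {A : Set X} (hA : MeasurableSet A) :
    MeasurableSet (shift t A) :=
  measurable_const_vadd t hA

theorem measurable_measureReal_shift_symmDiff (μ : Measure X) [IsFiniteMeasure μ] {A E : Set X}
    (hA : MeasurableSet A) (hE : MeasurableSet E) :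
    Measurable fun t : ℝ => μ.real (shift t A ∆ E) := by
  have h1 : MeasurableSet {p : ℝ × X | p.1 +ᵥ p.2 ∈ A} :=
    (measurable_fst.vadd measurable_snd) hA
  have h2 : MeasurableSet ({p : ℝ × X | p.1 +ᵥ p.2 ∈ A} ∆ (Prod.snd ⁻¹' E)) :=
    h1.symmDiff (measurable_snd hE)
  exact (measurable_measure_prodMk_left (ν := μ) h2).ennreal_toReal

variable (μ : Measure X) [VAddInvariantMeasure ℝ X μ]

theorem measureReal_shift_symmDiff_shift (s t : ℝ) {A B : Set X} (hA : MeasurableSet A)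
    (hB : MeasurableSet B) :
    μ.real (shift s A ∆ shift t B) = μ.real (shift (s - t) A ∆ B) := by
  have : shift s A ∆ shift t B = shift t (shift (s - t) A ∆ B) := by
    have h : shift s A = shift t (shift (s - t) A) := by rw [shift_shift]; congr 1; ring
    rw [h]; rfl
  rw [this, measureReal_shift μ t ((measurableSet_shift _ hA).symmDiff hB)]

theorem measureReal_symmDiff_shift_neg (t : ℝ) {A : Set X} (hA : MeasurableSet A) :
    μ.real (shift (-t) A ∆ A) = μ.real (shift t A ∆ A) := by
  have h := measureReal_shift_symmDiff_shift μ 0 t hA hA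
  rw [shift_zero, zero_sub] at h
  rw [← h, symmDiff_comm]

/-- A measurable action on a countably generated finite measure space is continuous
on the measure algebra. -/
theorem tendsto_measureReal_shift_symmDiff [MeasurableSpace.CountablyGenerated X]
    [IsFiniteMeasure μ] {A : Set X} (hA : MeasurableSet A) :
    Tendsto (fun t : ℝ => μ.real (shift t A ∆ A)) (𝓝 0) (𝓝 0) := by
  obtain ⟨E, hE, hd⟩ := exists_countable_dense_sets μ
  rw [Metric.tendsto_nhds]
  intro ε hε
  set P : ℕ → Set ℝ := fun n => {t | μ.real (shift t A ∆ E n) < ε / 2} with hP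
  have hPm : ∀ n, MeasurableSet (P n) := fun n =>
    measurable_measureReal_shift_symmDiff μ hA (hE n) measurableSet_Iio
  have hcov : ⋃ n, P n = univ := by
    refine eq_univ_of_forall fun t => mem_iUnion.2 ?_
    exact hd _ (measurableSet_shift t hA) (ε / 2) (by positivity)
  -- Two times in the same `P n` bring `A` within `ε / 2` of one `E n`. Some `P n` has positive
  -- Lebesgue measure, so by Steinhaus its differences fill a neighbourhood of 0.
  obtain ⟨n, hn⟩ : ∃ n, 0 < volume (P n) := by
    by_contra! h
    have : volume (⋃ n, P n) = 0 := measure_iUnion_null fun n => le_antisymm (h n) zero_le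
    rw [hcov] at this
    simp at this
  filter_upwards [Measure.sub_mem_nhds_zero_of_addHaar_pos volume (P n) (hPm n) hn] with t ht
  obtain ⟨a, ha, b, hb, rfl⟩ := ht
  rw [Real.dist_eq, sub_zero, abs_of_nonneg measureReal_nonneg]
  simp only
  rw [← measureReal_shift_symmDiff_shift μ a b hA hA]
  have h1 := measureReal_symmDiff_le (μ := μ) (s := shift a A) (t := E n) (shift b A)
  have h2 : μ.real (E n ∆ shift b A) < ε / 2 := by rw [symmDiff_comm]; exact hb
  have h3 : μ.real (shift a A ∆ E n) < ε / 2 := ha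
  linarith

/-- A set that is null-invariant under a dense family of times is null-invariant. -/
theorem shift_ae_eq_of_rat [MeasurableSpace.CountablyGenerated X]
    [IsFiniteMeasure μ] {A : Set X} (hA : MeasurableSet A)
    (h : ∀ q : ℚ, shift (q : ℝ) A =ᵐ[μ] A) (t : ℝ) : shift t A =ᵐ[μ] A := by
  rw [← measure_symmDiff_eq_zero_iff, ← measureReal_eq_zero_iff]
  refine le_antisymm (le_of_forall_pos_lt_add fun ε hε => ?_) measureReal_nonneg
  have h1 := (tendsto_measureReal_shift_symmDiff μ hA).eventually_lt_const hε
  obtain ⟨δ, hδ, hball⟩ := Metric.eventually_nhds_iff.1 h1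
  obtain ⟨q, hq⟩ := exists_rat_near t hδ
  have h2 : μ.real (shift (t - q) A ∆ A) < ε := hball (by simpa [Real.dist_eq] using hq)
  rw [← measureReal_shift_symmDiff_shift μ t q hA hA] at h2
  rw [zero_add]
  refine lt_of_le_of_lt (le_of_eq ?_) h2
  exact measureReal_congr ((ae_eq_refl _).symmDiff (h q).symm)

end Shift

/-! ### Fibre measures and local sections of finite extensions -/

theorem setLIntegral_condExpKernel {X : Type*} {m mX : MeasurableSpace X} [StandardBorelSpace X]
    (μ : Measure X) [IsFiniteMeasure μ] (hm : m ≤ mX) {Q G : Set X} (hQ : MeasurableSet[m] Q)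
    (hG : MeasurableSet G) : ∫⁻ x in Q, condExpKernel μ m x G ∂μ = μ (Q ∩ G) := by
  have h := congrArg (fun ρ => ρ (Q ×ˢ G)) (compProd_trim_condExpKernel (μ := μ) hm)
  beta_reduce at h
  have hd : @Measurable X (X × X) mX (m.prod mX) Function.diag :=
    Measurable.prodMk (measurable_id'' hm) measurable_id
  rw [Measure.map_apply hd (@MeasurableSet.prod _ _ m mX _ _ hQ hG),
    Measure.compProd_apply_prod hQ hG,
    restrict_trim hm _ hQ, lintegral_trim hm (measurable_condExpKernel hG)] at h
  rw [h]
  congr 1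

/-- If `μ` is a finite extension of `m`, then on some set of positive measure every measurable set
coincides with a set of `m`. -/
theorem IsFiniteExtension.exists_section {X : Type*} {m mX : MeasurableSpace X}
    [StandardBorelSpace X] {μ : Measure X} [IsProbabilityMeasure μ] (hm : m ≤ mX)
    (h : IsFiniteExtension m μ) :
    ∃ C, MeasurableSet C ∧ μ C ≠ 0 ∧
      ∀ D, MeasurableSet D → ∃ M, MeasurableSet[m] M ∧ (D ∩ C : Set X) =ᵐ[μ] (M ∩ C : Set X) := by
  let := upgradeStandardBorel X
  obtain ⟨G, hG⟩ := (TopologicalSpace.countable_countableBasis X).exists_eq_range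
    (by
      obtain ⟨x⟩ := μ.nonempty_of_neZero
      obtain ⟨V, hV, -, -⟩ := (TopologicalSpace.isBasis_countableBasis X).exists_subset_of_mem_open
        (mem_univ x) isOpen_univ
      exact ⟨V, hV⟩)
  have hbasis := TopologicalSpace.isBasis_countableBasis X
  have hGo : ∀ i, IsOpen (G i) := fun i =>
    hbasis.isOpen (hG ▸ mem_range_self i)
  have hGm : ∀ i, MeasurableSet (G i) := fun i => (hGo i).measurableSet
  set κ := condExpKernel μ m with hκ
  -- Over `Q j` the fibre measure charges `G j` and, restricted to it, gives each basic set zero or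
  -- full mass: `G j` isolates a single atom.
  set Q : ℕ → Set X := fun j => {x | κ x (G j) ≠ 0} ∩
    ⋂ i, ({x | κ x (G j ∩ G i) = 0} ∪ {x | κ x (G j \ G i) = 0}) with hQ
  have hκm : ∀ {s}, MeasurableSet s → MeasurableSet[m] {x | κ x s = 0} := fun hs =>
    measurable_condExpKernel hs (measurableSet_singleton 0)
  have hQm : ∀ j, MeasurableSet[m] (Q j) := fun j =>
    MeasurableSet.inter (hκm (hGm j)).compl
      (MeasurableSet.iInter fun i => (hκm ((hGm j).inter (hGm i))).union
        (hκm ((hGm j).diff (hGm i))))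
  have hcov : ∀ᵐ x ∂μ, x ∈ ⋃ j, Q j := by
    filter_upwards [h] with x hx
    obtain ⟨F, hF, hF0⟩ := hx
    obtain ⟨p, hpF, hp⟩ : ∃ p ∈ F, κ x {p} ≠ 0 := by
      by_contra! hcon
      have h1 : κ x F = 0 := by
        rw [← biUnion_of_singleton F]
        exact (measure_biUnion_null_iff hF.countable).2 hcon
      have h2 : κ x univ ≤ κ x F + κ x Fᶜ := by
        rw [← union_compl_self F]; exact measure_union_le _ _
      rw [h1, hF0, measure_univ] at h2
      simp at h2
    -- Finiteness of `F` enters here: the other points form a closed set, so a basic open set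
    -- separates `p` from them.
    obtain ⟨V, hV, hpV, hVF⟩ := hbasis.exists_subset_of_mem_open (a := p) (u := (F \ {p})ᶜ)
      (by simp) (hF.sdiff.isClosed.isOpen_compl)
    rw [hG] at hV
    obtain ⟨j, rfl⟩ := hV
    have hnull : κ x (G j \ {p}) = 0 := by
      refine measure_mono_null (fun y hy => ?_) hF0
      intro hyF
      exact hVF hy.1 ⟨hyF, hy.2⟩
    refine mem_iUnion.2 ⟨j, fun h0 => hp (measure_mono_null (singleton_subset_iff.2 hpV) h0),
      mem_iInter.2 fun i => ?_⟩
    by_cases hpi : p ∈ G i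
    · right
      refine measure_mono_null (fun y hy => ?_) hnull
      exact ⟨hy.1, fun hyp => hy.2 (by rwa [show y = p from hyp])⟩
    · left
      refine measure_mono_null (fun y hy => ?_) hnull
      exact ⟨hy.1, fun hyp => hpi (by rw [← show y = p from hyp]; exact hy.2)⟩
  obtain ⟨j, hj⟩ : ∃ j, μ (Q j) ≠ 0 := by
    by_contra! hcon
    have h1 : μ (⋃ j, Q j) = 0 := measure_iUnion_null hcon
    have h2 : μ (⋃ j, Q j) = 1 := by
      rw [← measure_univ (μ := μ)]
      exact measure_congr (eventuallyEq_univ.2 hcov)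
    simp [h1] at h2
  have hnull : ∀ {R s : Set X}, MeasurableSet[m] R → MeasurableSet s → (∀ x ∈ R, κ x s = 0) →
      μ (R ∩ s) = 0 := by
    intro R s hR hs h0
    rw [← setLIntegral_condExpKernel μ hm hR hs, setLIntegral_congr_fun (hm _ hR) h0]
    simp
  refine ⟨Q j ∩ G j, (hm _ (hQm j)).inter (hGm j), fun h0 => ?_, fun D hD => ?_⟩
  · rw [← setLIntegral_condExpKernel μ hm (hQm j) (hGm j),
      lintegral_eq_zero_iff ((measurable_condExpKernel (hGm j)).mono hm le_rfl)] at h0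
    apply hj
    have h1 : ∀ᵐ x ∂μ, x ∈ Q j → κ x (G j) = 0 := (ae_restrict_iff' (hm _ (hQm j))).1 h0
    refine measure_mono_null ?_ h1
    intro x hx h2
    exact hx.1 (h2 hx)
  · have hgen : mX = MeasurableSpace.generateFrom (range G) := by
      rw [← hG, ← hbasis.borel_eq_generateFrom]
      exact BorelSpace.measurable_eq
    induction D, (hgen ▸ hD : MeasurableSet[MeasurableSpace.generateFrom (range G)] D) using
      MeasurableSpace.generateFrom_induction with
    | hC t ht _ =>
      obtain ⟨i, rfl⟩ := ht
      -- Whether the atom in `G j` lies in `G i` depends on the fibre alone, and this condition is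
      -- `m`-measurable.
      have hM : MeasurableSet[m] {x | κ x (G j \ G i) = 0} := hκm ((hGm j).diff (hGm i))
      refine ⟨{x | κ x (G j \ G i) = 0}, hM, ?_⟩
      rw [ae_eq_set]
      constructor
      · refine measure_mono_null ?_ (hnull ((hQm j).diff hM) ((hGm j).inter (hGm i)) ?_)
        · rintro x ⟨⟨hx1, hx2, hx3⟩, hx4⟩
          exact ⟨⟨hx2, fun h => hx4 ⟨h, hx2, hx3⟩⟩, hx3, hx1⟩
        · rintro x ⟨hx1, hx2⟩
          exact (mem_iInter.1 hx1.2 i).resolve_right hx2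
      · refine measure_mono_null ?_ (hnull hM ((hGm j).diff (hGm i)) fun x hx => hx)
        rintro x ⟨⟨hx1, hx2, hx3⟩, hx4⟩
        exact ⟨hx1, hx3, fun h => hx4 ⟨h, hx2, hx3⟩⟩
    | empty => exact ⟨∅, @MeasurableSet.empty _ m, by simp⟩
    | compl t ht ih =>
      obtain ⟨M, hM, hMt⟩ := ih (by rw [hgen]; exact ht)
      refine ⟨Mᶜ, hM.compl, ?_⟩
      filter_upwards [hMt] with x hx
      have hx' : (x ∈ t ∧ x ∈ Q j ∩ G j) ↔ (x ∈ M ∧ x ∈ Q j ∩ G j) := by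
        exact Iff.of_eq hx
      refine propext ?_
      change (¬ x ∈ t ∧ x ∈ Q j ∩ G j) ↔ (¬ x ∈ M ∧ x ∈ Q j ∩ G j)
      tauto
    | iUnion t ht ih =>
      choose M hM hMt using fun n => ih n (by rw [hgen]; exact ht n)
      refine ⟨⋃ n, M n, MeasurableSet.iUnion hM, ?_⟩
      rw [iUnion_inter, iUnion_inter]
      exact Filter.EventuallyEq.countable_iUnion hMt

/-! ### Weak compactness and a pigeonhole principle -/

/-- Indicators of a sequence of sets have a subsequence that converges weakly in `L²`. -/
theorem exists_subseq_tendsto_measureReal_inter {X : Type*} [MeasurableSpace X]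
    [MeasurableSpace.CountablyGenerated X] (μ : Measure X) [IsProbabilityMeasure μ]
    {S : ℕ → Set X} (hS : ∀ n, MeasurableSet (S n)) :
    ∃ φ : ℕ → ℕ, StrictMono φ ∧ ∃ w : X → ℝ, StronglyMeasurable w ∧ Integrable w μ ∧
      ∀ E, MeasurableSet E →
        Tendsto (fun n => μ.real (E ∩ S (φ n))) atTop (𝓝 (∫ x in E, w x ∂μ)) := by
  have : Fact ((2 : ℝ≥0∞) ≠ ∞) := ⟨ENNReal.ofNat_ne_top⟩
  set f : ℕ → Lp ℝ 2 μ := fun n => indicatorConstLp 2 (hS n) (measure_ne_top _ _) 1 with hf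
  set x : ℕ → WeakDual ℝ (Lp ℝ 2 μ) := fun n =>
    StrongDual.toWeakDual (InnerProductSpace.toDual ℝ (Lp ℝ 2 μ) (f n)) with hx
  have hball : ∀ n, x n ∈ WeakDual.toStrongDual ⁻¹' Metric.closedBall
      (0 : StrongDual ℝ (Lp ℝ 2 μ)) 1 := by
    intro n
    have h1 : ‖InnerProductSpace.toDual ℝ (Lp ℝ 2 μ) (f n)‖ ≤ 1 := by
      rw [LinearIsometryEquiv.norm_map]
      refine norm_indicatorConstLp_le.trans ?_
      rw [norm_one, one_mul]
      exact Real.rpow_le_one measureReal_nonneg measureReal_le_one (by positivity)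
    exact mem_closedBall_zero_iff.2 h1
  -- Sequential Banach–Alaoglu; the Riesz isometry turns the limit functional into a function.
  obtain ⟨a, -, φ, hφ, ha⟩ := WeakDual.isSeqCompact_closedBall ℝ (Lp ℝ 2 μ) 0 1 hball
  set g : Lp ℝ 2 μ := (InnerProductSpace.toDual ℝ (Lp ℝ 2 μ)).symm (WeakDual.toStrongDual a)
  refine ⟨φ, hφ, g, Lp.stronglyMeasurable g, (Lp.memLp g).integrable (by norm_num),
    fun E hE => ?_⟩
  have h2 := ((WeakDual.eval_continuous
    (indicatorConstLp 2 hE (measure_ne_top μ E) (1 : ℝ))).tendsto a).comp ha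
  have h3 : a (indicatorConstLp 2 hE (measure_ne_top μ E) (1 : ℝ)) = ∫ x in E, g x ∂μ := by
    rw [← L2.inner_indicatorConstLp_one (𝕜 := ℝ) hE (measure_ne_top μ E) g, real_inner_comm,
      InnerProductSpace.toDual_symm_apply]
    rfl
  rw [h3] at h2
  refine h2.congr fun n => ?_
  change inner ℝ (f (φ n)) (indicatorConstLp 2 hE (measure_ne_top μ E) (1 : ℝ)) = _
  rw [L2.inner_indicatorConstLp_one_indicatorConstLp_one, inter_comm]
  rfl

/-- Among infinitely many sets of measure bounded below, two far out in the sequence intersect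
in a set of measure bounded below. -/
theorem exists_lt_measureReal_inter {X : Type*} [MeasurableSpace X] (μ : Measure X)
    [IsProbabilityMeasure μ] {S : ℕ → Set X} (hS : ∀ n, MeasurableSet (S n)) {a : ℝ} (ha : 0 < a)
    (hSa : ∀ n, a ≤ μ.real (S n)) :
    ∃ δ > 0, ∀ N, ∃ i j, N ≤ j ∧ j < i ∧ δ ≤ μ.real (S i ∩ S j) := by
  obtain ⟨K, hK⟩ := exists_nat_gt (2 / a)
  have hK0 : (0 : ℝ) < K := lt_trans (by positivity) hK
  refine ⟨a / (2 * K), by positivity, fun N => ?_⟩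
  by_contra! hcon
  -- If all overlaps were below `a / (2 * K)`, each new set would add at least `a / 2`, and `K > 2 /
  -- a` of them would exceed total mass 1.
  have hdisj : ∀ n ≤ K, n * (a / 2) ≤ μ.real (⋃ i ∈ Finset.range n, S (N + i)) := by
    intro n
    induction n with
    | zero => intro; simp
    | succ n ih =>
      intro hn
      set U := ⋃ i ∈ Finset.range n, S (N + i) with hU
      have hUm : MeasurableSet U := Finset.measurableSet_biUnion _ fun i _ => hS _
      have h1 : ⋃ i ∈ Finset.range (n + 1), S (N + i) = U ∪ (S (N + n) \ U) := by
        rw [union_sdiff_self, Finset.range_add_one, Finset.set_biUnion_insert, union_comm]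
      have h2 : μ.real (S (N + n) ∩ U) ≤ a / 2 := by
        rw [hU, inter_iUnion₂]
        calc μ.real (⋃ i ∈ Finset.range n, S (N + n) ∩ S (N + i))
            ≤ ∑ i ∈ Finset.range n, μ.real (S (N + n) ∩ S (N + i)) :=
              measureReal_biUnion_finset_le _ _
          _ ≤ ∑ i ∈ Finset.range n, a / (2 * K) := by
              refine Finset.sum_le_sum fun i hi => (hcon _ _ (by omega) ?_).le
              have := Finset.mem_range.1 hi
              omega
          _ = n * (a / (2 * K)) := by simp
          _ ≤ K * (a / (2 * K)) := by
              gcongr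
              omega
          _ = a / 2 := by field_simp
      have h3 := measureReal_inter_add_sdiff (μ := μ) (s := S (N + n)) hUm
      rw [h1, measureReal_union disjoint_sdiff_right ((hS _).diff hUm) (measure_ne_top _ _)
        (measure_ne_top _ _)]
      have h4 := ih (by omega)
      have h5 := hSa (N + n)
      push_cast
      linarith
  have h6 := (hdisj K le_rfl).trans measureReal_le_one
  rw [div_lt_iff₀ ha] at hK
  linarith

/-! ### Rigid sets along a sequence of times, and recurrent sets -/

theorem measureReal_shift_symmDiff_le_of_approx {X : Type*} [MeasurableSpace X] [AddAction ℝ X]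
    (μ : Measure X) [VAddInvariantMeasure ℝ X μ] [IsFiniteMeasure μ] (t : ℝ) {A B : Set X} (hA : MeasurableSet A)
    (hB : MeasurableSet B) :
    μ.real (shift t A ∆ A) ≤ μ.real (shift t B ∆ B) + 2 * μ.real (A ∆ B) := by
  have h1 := measureReal_symmDiff_le (μ := μ) (s := shift t A) (t := shift t B) A
  have h2 := measureReal_symmDiff_le (μ := μ) (s := shift t B) (t := B) A
  have h3 : μ.real (shift t A ∆ shift t B) = μ.real (A ∆ B) :=
    measureReal_shift μ t (hA.symmDiff hB)
  rw [symmDiff_comm B A] at h2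
  linarith

theorem tendsto_shift_symmDiff_union {X : Type*} [MeasurableSpace X] [AddAction ℝ X] (μ : Measure X)
    [IsFiniteMeasure μ] {t : ℕ → ℝ} {A B : Set X}
    (hA : Tendsto (fun n => μ.real (shift (t n) A ∆ A)) atTop (𝓝 0))
    (hB : Tendsto (fun n => μ.real (shift (t n) B ∆ B)) atTop (𝓝 0)) :
    Tendsto (fun n => μ.real (shift (t n) (A ∪ B) ∆ (A ∪ B))) atTop (𝓝 0) := by
  refine squeeze_zero (fun _ => measureReal_nonneg) (fun n => ?_) (by simpa using hA.add hB)
  refine (measureReal_mono ?_).trans (measureReal_union_le _ _)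
  rintro x (⟨h1 | h1, h2⟩ | ⟨h1 | h1, h2⟩)
  · exact Or.inl (Or.inl ⟨h1, fun h => h2 (Or.inl h)⟩)
  · exact Or.inr (Or.inl ⟨h1, fun h => h2 (Or.inr h)⟩)
  · exact Or.inl (Or.inr ⟨h1, fun h => h2 (Or.inl h)⟩)
  · exact Or.inr (Or.inr ⟨h1, fun h => h2 (Or.inr h)⟩)

section Rigid

variable {X : Type*} [mX : MeasurableSpace X] [AddAction ℝ X] [MeasurableVAdd₂ ℝ X]
  (μ : Measure X) [VAddInvariantMeasure ℝ X μ] [IsFiniteMeasure μ]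

/-- The σ-algebra of the sets that are rigid along a sequence of times. -/
abbrev rigidSigmaAlgebra (t : ℕ → ℝ) : MeasurableSpace X where
  MeasurableSet' A := MeasurableSet A ∧ Tendsto (fun n => μ.real (shift (t n) A ∆ A)) atTop (𝓝 0)
  measurableSet_empty := ⟨MeasurableSet.empty, by simp [shift]⟩
  measurableSet_compl A hA := by
    refine ⟨hA.1.compl, hA.2.congr fun n => ?_⟩
    change _ = μ.real ((shift (t n) A)ᶜ ∆ Aᶜ)
    rw [compl_symmDiff_compl]
  measurableSet_iUnion A hA := by
    have hAm : ∀ n, MeasurableSet (A n) := fun n => (hA n).1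
    have hUm : MeasurableSet (⋃ n, A n) := MeasurableSet.iUnion hAm
    refine ⟨hUm, ?_⟩
    have hacm : ∀ k, MeasurableSet (accumulate A k) := fun k =>
      MeasurableSet.biUnion (to_countable _) fun i _ => hAm i
    have hac : ∀ k, Tendsto (fun n => μ.real (shift (t n) (accumulate A k) ∆ accumulate A k))
        atTop (𝓝 0) := by
      intro k
      induction k with
      | zero => simpa [accumulate] using (hA 0).2
      | succ k ih =>
        rw [accumulate_succ]
        exact tendsto_shift_symmDiff_union μ ih (hA (k + 1)).2
    have happ : Tendsto (fun k => μ.real (accumulate A k)) atTop (𝓝 (μ.real (⋃ n, A n))) :=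
      (ENNReal.tendsto_toReal (measure_ne_top _ _)).comp tendsto_measure_iUnion_accumulate
    rw [Metric.tendsto_atTop]
    intro ε hε
    -- The approximation error counts twice, for the set and for its shift, hence `ε / 4`.
    obtain ⟨k, hk⟩ := (happ.eventually_const_lt (sub_lt_self _ (by positivity : 0 < ε / 4))).exists
    obtain ⟨N, hN⟩ := eventually_atTop.1 ((hac k).eventually_lt_const (half_pos hε))
    refine ⟨N, fun n hn => ?_⟩
    rw [Real.dist_eq, sub_zero, abs_of_nonneg measureReal_nonneg]
    have hsub : accumulate A k ⊆ ⋃ n, A n := accumulate_subset_iUnion k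
    have h1 : μ.real ((⋃ n, A n) ∆ accumulate A k) = μ.real (⋃ n, A n) - μ.real (accumulate A k) := by
      rw [symmDiff_def, sdiff_eq_bot_iff.2 hsub, sup_bot_eq, measureReal_sdiff hsub (hacm k)]
    have h2 := measureReal_shift_symmDiff_le_of_approx μ (t n) hUm (hacm k)
    have h3 := hN n hn
    linarith

/-- Time maps commute and preserve `μ`, so shifting a set does not change its displacement under `t
n`. -/
theorem isFactor_rigidSigmaAlgebra (t : ℕ → ℝ) : IsFactor (rigidSigmaAlgebra μ t) mX where
  le _ hA := hA.1
  invariant s A hA := by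
    refine ⟨measurableSet_shift s hA.1, hA.2.congr fun n => ?_⟩
    change _ = μ.real (shift (t n) (shift s A) ∆ shift s A)
    rw [shift_shift, measureReal_shift_symmDiff_shift μ _ _ hA.1 hA.1]
    congr 3
    ring

end Rigid

/-- A set is recurrent under a flow if it returns arbitrarily close to itself at
arbitrarily large times. -/
def IsRecurrentSet {X : Type*} [MeasurableSpace X] [AddAction ℝ X] (μ : Measure X) (A : Set X) :
    Prop :=
  ∀ ε > 0, ∀ N : ℝ, ∃ t > N, μ.real (shift t A ∆ A) < ε

/-- A recurrent set is rigid along a sequence of times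
with gaps tending to infinity. -/
theorem IsRecurrentSet.exists_seq {X : Type*} [MeasurableSpace X] [AddAction ℝ X]
    (μ : Measure X) {A : Set X}
    (hA : IsRecurrentSet μ A) :
    ∃ t : ℕ → ℝ, (∀ j i : ℕ, j < i → (j : ℝ) ≤ t i - t j) ∧
      Tendsto (fun n => μ.real (shift (t n) A ∆ A)) atTop (𝓝 0) := by
  have hex : ∀ (n : ℕ) (N : ℝ), ∃ t > N, μ.real (shift t A ∆ A) < 1 / ((n : ℝ) + 1) :=
    fun n N => hA _ (by positivity) N
  choose F hF hFd using hex
  let t : ℕ → ℝ := fun n => Nat.rec (F 0 0) (fun k p => F (k + 1) (p + k)) n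
  have hstep : ∀ n : ℕ, t n + n < t (n + 1) := fun n => hF (n + 1) (t n + n)
  have hmono : Monotone t := monotone_nat_of_le_succ fun n => by
    have := hstep n
    have h0 : (0 : ℝ) ≤ n := n.cast_nonneg
    linarith
  have hd : ∀ n, μ.real (shift (t n) A ∆ A) < 1 / ((n : ℝ) + 1) := by
    intro n
    cases n with
    | zero => exact hFd 0 0
    | succ k => exact hFd (k + 1) (t k + k)
  refine ⟨t, fun j i hji => ?_, ?_⟩
  · have h1 := hstep j
    have h2 : t (j + 1) ≤ t i := hmono hji
    linarith
  · exact squeeze_zero (fun _ => measureReal_nonneg) (fun n => (hd n).le)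
      tendsto_one_div_add_atTop_nhds_zero_nat

/-- The translates under rational times of a set of positive measure cover almost everything. -/
theorem iUnion_shift_rat_ae_eq_univ {X : Type*} [MeasurableSpace X]
    [MeasurableSpace.CountablyGenerated X] [AddAction ℝ X] [MeasurableVAdd₂ ℝ X]
    (μ : Measure X) [IsFiniteMeasure μ] [ErgodicVAdd ℝ X μ] {C : Set X} (hC : MeasurableSet C)
    (hC0 : μ C ≠ 0) : (⋃ q : ℚ, shift (q : ℝ) C : Set X) =ᵐ[μ] univ := by
  have hm : MeasurableSet (⋃ q : ℚ, shift (q : ℝ) C) :=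
    MeasurableSet.iUnion fun q => measurableSet_shift _ hC
  have hinv : ∀ q : ℚ, shift (q : ℝ) (⋃ q : ℚ, shift (q : ℝ) C) = ⋃ q : ℚ, shift (q : ℝ) C := by
    intro q
    ext x
    simp only [shift, mem_preimage, mem_iUnion, ← add_vadd]
    constructor
    · rintro ⟨r, hr⟩
      exact ⟨r + q, by push_cast; exact hr⟩
    · rintro ⟨r, hr⟩
      exact ⟨r - q, by push_cast; rwa [sub_add_cancel]⟩
  rcases eventuallyConst_set'.1 (ErgodicVAdd.aeconst_of_forall_preimage_vadd_ae_eq (G := ℝ) hm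
    (shift_ae_eq_of_rat μ hm fun q => .of_eq (hinv q))) with h | h
  · exfalso
    refine hC0 (measure_mono_null ?_ (ae_eq_empty.1 h))
    intro x hx
    exact mem_iUnion.2 ⟨0, by simpa [shift] using hx⟩
  · exact h

/-! ### From recurrence to partial rigidity -/

section PartialRigidity

variable {X : Type*} [MeasurableSpace X] [AddAction ℝ X] [MeasurableVAdd₂ ℝ X]
  (μ : Measure X)

/-- Conjugation by the time-`s` map, which commutes with the flow, moves the estimate from `C` to
its translate. -/
theorem liminf_measure_inter_shift_of_subset_shift [VAddInvariantMeasure ℝ X μ]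
    {σ : ℕ → ℝ} {c : ℝ≥0∞} {C : Set X}
    (h : ∀ D ⊆ C, MeasurableSet D → c * μ D ≤ liminf (fun n => μ (D ∩ shift (σ n) D)) atTop)
    (s : ℝ) {D : Set X} (hDC : D ⊆ shift s C) (hD : MeasurableSet D) :
    c * μ D ≤ liminf (fun n => μ (D ∩ shift (σ n) D)) atTop := by
  have hD' : MeasurableSet (shift (-s) D) := measurableSet_shift _ hD
  have h1 := h (shift (-s) D) (fun x hx => by
    have := hDC hx
    simpa [shift] using this) hD'
  rw [measure_shift μ _ hD] at h1
  refine h1.trans_eq (congrArg (fun f => liminf f atTop) (funext fun n => ?_))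
  rw [← measure_shift μ (-s) (hD.inter (measurableSet_shift (σ n) hD)), shift_shift]
  congr 1
  change _ = shift (-s) D ∩ shift (-s) (shift (σ n) D)
  rw [shift_shift, add_comm]

/-- The inequality defining partial rigidity extends from the subsets of one set of positive
measure to all sets. -/
theorem liminf_measure_inter_shift_of_ergodic [MeasurableSpace.CountablyGenerated X]
    [IsFiniteMeasure μ] [ErgodicVAdd ℝ X μ] {σ : ℕ → ℝ} {c : ℝ≥0∞} {C : Set X}
    (hC : MeasurableSet C) (hC0 : μ C ≠ 0)
    (h : ∀ D ⊆ C, MeasurableSet D → c * μ D ≤ liminf (fun n => μ (D ∩ shift (σ n) D)) atTop)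
    {D : Set X} (hD : MeasurableSet D) :
    c * μ D ≤ liminf (fun n => μ (D ∩ shift (σ n) D)) atTop := by
  obtain ⟨e, he⟩ := exists_surjective_nat ℚ
  set V : ℕ → Set X := fun k => shift (e k : ℝ) C with hV
  have hVm : ∀ k, MeasurableSet (V k) := fun k => measurableSet_shift _ hC
  have hVu : (⋃ k, V k : Set X) =ᵐ[μ] univ := by
    rw [hV, he.iUnion_comp (g := fun q : ℚ => shift (q : ℝ) C)]
    exact iUnion_shift_rat_ae_eq_univ μ hC hC0
  set P : ℕ → Set X := fun k => D ∩ disjointed V k with hP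
  have hPm : ∀ k, MeasurableSet (P k) := fun k => hD.inter (MeasurableSet.disjointed hVm k)
  have hPd : Pairwise (Function.onFun Disjoint P) := fun i j hij =>
    ((disjoint_disjointed V) hij).mono inter_subset_right inter_subset_right
  have hPu : (⋃ k, P k : Set X) =ᵐ[μ] D := by
    rw [hP, ← inter_iUnion, iUnion_disjointed]
    simpa using (ae_eq_refl D).inter hVu
  have hPV : ∀ k, P k ⊆ shift (e k : ℝ) C := fun k x hx => disjointed_subset V k hx.2
  calc c * μ D = ∑' k, c * μ (P k) := by
        rw [← measure_congr hPu, measure_iUnion hPd hPm, ENNReal.tsum_mul_left]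
    _ ≤ ∑' k, liminf (fun n => μ (P k ∩ shift (σ n) (P k))) atTop :=
        ENNReal.tsum_le_tsum fun k =>
          liminf_measure_inter_shift_of_subset_shift μ h _ (hPV k) (hPm k)
    _ ≤ liminf (fun n => ∑' k, μ (P k ∩ shift (σ n) (P k))) atTop := by
        -- Fatou's lemma for counting measure.
        simp only [← lintegral_count]
        exact lintegral_liminf_le fun n => measurable_from_nat
    _ ≤ liminf (fun n => μ (D ∩ shift (σ n) D)) atTop := by
        refine liminf_le_liminf (Eventually.of_forall fun n => ?_)
        rw [← measure_iUnion (fun i j hij => (hPd hij).mono inter_subset_left inter_subset_left)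
          fun k => (hPm k).inter (measurableSet_shift _ (hPm k))]
        refine measure_mono (iUnion_subset fun k => ?_)
        exact inter_subset_inter inter_subset_left (preimage_mono inter_subset_left)

end PartialRigidity

/-- An ergodic flow that is a finite extension of each non-trivial factor and has a non-trivial
recurrent set is partially rigid. -/
theorem isPartiallyRigid_of_isRecurrentSet {X : Type*} [mX : MeasurableSpace X]
    [StandardBorelSpace X] [AddAction ℝ X] [MeasurableVAdd₂ ℝ X]
    (μ : Measure X) [IsProbabilityMeasure μ] [ErgodicVAdd ℝ X μ]
    (hfin : ∀ m : MeasurableSpace X, IsFactor m mX → IsNontrivial m μ → IsFiniteExtension m μ)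
    {A : Set X} (hAm : MeasurableSet A) (hA0 : μ A ≠ 0) (hA1 : μ Aᶜ ≠ 0)
    (hA : IsRecurrentSet μ A) :
    IsPartiallyRigid μ := by
  obtain ⟨t, htgap, htA⟩ := IsRecurrentSet.exists_seq μ hA
  have hfac := isFactor_rigidSigmaAlgebra μ t
  obtain ⟨C, hC, hC0, hCm⟩ := IsFiniteExtension.exists_section hfac.le
    (hfin _ hfac ⟨A, ⟨hAm, htA⟩, hA0, hA1⟩)
  have hCpos : 0 < μ.real C := ENNReal.toReal_pos hC0 (measure_ne_top _ _)
  obtain ⟨δ, hδ, hpig⟩ := exists_lt_measureReal_inter μ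
    (fun n => measurableSet_shift (t n) hC) hCpos (fun n => (measureReal_shift μ (t n) hC).ge)
  choose i j hj hij hδij using hpig
  -- Differences of rigidity times are again rigidity times for every factor set; the growing gaps
  -- send them to infinity.
  set τ : ℕ → ℝ := fun n => t (i n) - t (j n) with hτ
  have hτn : ∀ n : ℕ, (n : ℝ) ≤ τ n := fun n =>
    le_trans (by exact_mod_cast hj n) (htgap _ _ (hij n))
  have hτδ : ∀ n, δ ≤ μ.real (C ∩ shift (τ n) C) := by
    intro n
    refine (hδij n).trans_eq ?_
    rw [← measureReal_shift μ (t (j n)) (hC.inter (measurableSet_shift (τ n) hC))]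
    congr 1
    change _ = shift (t (j n)) C ∩ shift (t (j n)) (shift (τ n) C)
    rw [shift_shift, inter_comm, hτ, sub_add_cancel]
  have hjtop : Tendsto j atTop atTop := tendsto_atTop_mono hj tendsto_id
  have hitop : Tendsto i atTop atTop := tendsto_atTop_mono (fun n => (hij n).le) hjtop
  have hτM : ∀ M, MeasurableSet M →
      Tendsto (fun n => μ.real (shift (t n) M ∆ M)) atTop (𝓝 0) →
      Tendsto (fun n => μ.real (shift (τ n) M ∆ M)) atTop (𝓝 0) := by
    intro M hMm hM
    refine squeeze_zero (fun _ => measureReal_nonneg) (fun n => ?_)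
      (by simpa using (hM.comp hitop).add (hM.comp hjtop))
    rw [hτ, ← measureReal_shift_symmDiff_shift μ _ _ hMm hMm]
    refine (measureReal_symmDiff_le (t := M) _).trans_eq ?_
    rw [symmDiff_comm M]
  obtain ⟨φ, hφ, w, hwm, hwi, hw⟩ := exists_subseq_tendsto_measureReal_inter μ
    (fun n => hC.inter (measurableSet_shift (τ n) hC))
  -- The weak limit `w` has integral at least `δ` over `C`, so it cannot stay below `δ / 2` almost
  -- everywhere there.
  set C' : Set X := C ∩ {x | δ / 2 ≤ w x} with hC'
  have hC'm : MeasurableSet C' := hC.inter (measurableSet_le measurable_const hwm.measurable)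
  have hC'0 : μ C' ≠ 0 := by
    intro h0
    have h1 : δ ≤ ∫ x in C, w x ∂μ := by
      refine ge_of_tendsto (hw C hC) (Eventually.of_forall fun n => ?_)
      rw [← inter_assoc, inter_self]
      exact hτδ _
    have h2 : ∫ x in C, w x ∂μ ≤ ∫ x in C, δ / 2 ∂μ := by
      refine setIntegral_mono_on_ae hwi.integrableOn (integrable_const _).integrableOn hC ?_
      have h3 : ∀ᵐ x ∂μ, x ∉ C' := measure_eq_zero_iff_ae_notMem.1 h0
      filter_upwards [h3] with x hx hxC
      exact (not_le.1 fun h => hx ⟨hxC, h⟩).le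
    have h4 : ∫ x in C, δ / 2 ∂μ ≤ δ / 2 := by
      rw [setIntegral_const, smul_eq_mul]
      exact mul_le_of_le_one_left (by positivity) measureReal_le_one
    linarith
  have hσ : Tendsto (fun n => τ (φ n)) atTop atTop :=
    (tendsto_atTop_mono hτn tendsto_natCast_atTop_atTop).comp hφ.tendsto_atTop
  have hmain : ∀ D ⊆ C', MeasurableSet D → ENNReal.ofReal (δ / 2) * μ D ≤
      liminf (fun n => μ (D ∩ shift (τ (φ n)) D)) atTop := by
    intro D hDC hD
    obtain ⟨M, ⟨hMm, hM⟩, hDM⟩ := hCm D hD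
    rw [inter_eq_self_of_subset_left (hDC.trans inter_subset_left)] at hDM
    -- Since `D` is `M ∩ C` modulo null sets, a point of `D` that returns to `C` but not to `D` must
    -- leave `M`, and `M` is rigid.
    have h1 : ∀ n, μ.real (D ∩ (C ∩ shift (τ (φ n)) C)) - μ.real (shift (τ (φ n)) M ∆ M) ≤
        μ.real (D ∩ shift (τ (φ n)) D) := by
      intro n
      rw [sub_le_iff_le_add]
      refine le_trans (ENNReal.toReal_mono (measure_ne_top _ _) (measure_mono_ae ?_))
        (measureReal_union_le _ _)
      have hDM' : (shift (τ (φ n)) D : Set X) =ᵐ[μ] shift (τ (φ n)) (M ∩ C) :=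
        (measurePreserving_vadd (τ (φ n)) μ).quasiMeasurePreserving.preimage_ae_eq hDM
      filter_upwards [hDM, hDM'] with x hx hx' hxD
      obtain ⟨hx1, -, hx2⟩ := hxD
      have hxM : x ∈ M ∩ C := (Iff.of_eq hx).1 hx1
      by_cases hxs : x ∈ shift (τ (φ n)) M
      · exact Or.inl ⟨hx1, (Iff.of_eq hx').2 ⟨hxs, hx2⟩⟩
      · exact Or.inr (Or.inr ⟨hxM.1, hxs⟩)
    have h2 := (hw D hD).sub ((hτM M hMm hM).comp hφ.tendsto_atTop)
    rw [sub_zero] at h2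
    have h3 : δ / 2 * μ.real D ≤ ∫ x in D, w x ∂μ := by
      rw [mul_comm, ← smul_eq_mul, ← setIntegral_const]
      exact setIntegral_mono_on (integrable_const _).integrableOn hwi.integrableOn hD
        fun x hx => (hDC hx).2
    calc ENNReal.ofReal (δ / 2) * μ D = ENNReal.ofReal (δ / 2 * μ.real D) := by
          rw [ENNReal.ofReal_mul (by positivity), ofReal_measureReal]
      _ ≤ ENNReal.ofReal (∫ x in D, w x ∂μ) := ENNReal.ofReal_le_ofReal h3
      _ = liminf (fun n => ENNReal.ofReal (μ.real (D ∩ (C ∩ shift (τ (φ n)) C)) -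
            μ.real (shift (τ (φ n)) M ∆ M))) atTop :=
          ((ENNReal.continuous_ofReal.tendsto _).comp h2).liminf_eq.symm
      _ ≤ liminf (fun n => μ (D ∩ shift (τ (φ n)) D)) atTop := by
          refine liminf_le_liminf (Eventually.of_forall fun n => ?_)
          rw [← ofReal_measureReal (s := D ∩ shift (τ (φ n)) D)]
          exact ENNReal.ofReal_le_ofReal (h1 n)
  refine ⟨fun n => τ (φ n), hσ, min (ENNReal.ofReal (δ / 2)) 1,
    lt_min (ENNReal.ofReal_pos.2 (by positivity)) one_pos, min_le_right _ _, fun D hD => ?_⟩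
  exact (mul_le_mul_left (min_le_left _ _) _).trans
    (liminf_measure_inter_shift_of_ergodic μ hC'm hC'0 hmain hD)

/-! ### Strict invariance, orbits of non-recurrent sets and equivariant maps -/

/-- A set invariant modulo null sets under each time of a flow agrees almost everywhere with a
strictly invariant set. -/
theorem exists_strictly_invariant_ae_eq {Z : Type*} [MeasurableSpace Z] [AddAction ℝ Z]
    [MeasurableVAdd₂ ℝ Z] (ν : Measure Z) [SFinite ν] {B : Set Z} (hB : MeasurableSet B)
    (hinv : ∀ t : ℝ, shift t B =ᵐ[ν] B) :
    ∃ B', MeasurableSet B' ∧ (∀ t, shift t B' = B') ∧ B' =ᵐ[ν] B := by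
  have hm : MeasurableSet {p : Z × ℝ | p.2 +ᵥ p.1 ∈ B} :=
    (measurable_snd.vadd measurable_fst) hB
  -- The points whose orbit is in `B` at almost every time: strictly invariant because Lebesgue
  -- measure is, and almost equal to `B` by Fubini.
  refine ⟨{z | volume {t : ℝ | t +ᵥ z ∉ B} = 0}, ?_, fun s => ?_, ?_⟩
  · exact measurable_measure_prodMk_left (ν := (volume : Measure ℝ)) hm.compl
      (measurableSet_singleton 0)
  · ext z
    have h : {t : ℝ | t +ᵥ (s +ᵥ z) ∉ B} = (fun t => t + s) ⁻¹' {t : ℝ | t +ᵥ z ∉ B} := by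
      ext t
      simp [add_vadd]
    change volume {t : ℝ | t +ᵥ (s +ᵥ z) ∉ B} = 0 ↔ volume {t : ℝ | t +ᵥ z ∉ B} = 0
    rw [h, measure_preimage_add_right]
  · have hp : MeasurableSet {p : Z × ℝ | p.2 +ᵥ p.1 ∈ B ↔ p.1 ∈ B} :=
      hm.iff (measurable_fst hB)
    have h1 : ∀ᵐ z ∂ν, ∀ᵐ t : ℝ, (t +ᵥ z ∈ B ↔ z ∈ B) :=
      (Measure.ae_ae_comm hp).2 (Eventually.of_forall fun t => (hinv t).mem_iff)
    filter_upwards [h1] with z hz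
    refine propext ?_
    change (∀ᵐ t : ℝ, t +ᵥ z ∈ B) ↔ z ∈ B
    rw [eventually_congr hz, eventually_const]

section NonRecurrent

variable {X : Type*} [MeasurableSpace X] [AddAction ℝ X] [MeasurableVAdd₂ ℝ X]
  {μ : Measure X} [VAddInvariantMeasure ℝ X μ] [IsFiniteMeasure μ] {A : Set X}

/-- A coincidence would give `A` a period, and arbitrarily large multiples of it would make `A`
recurrent. -/
theorem eq_of_shift_ae_eq_shift (hA : MeasurableSet A) (hrec : ¬ IsRecurrentSet μ A) {σ τ : ℝ}
    (h : shift σ A =ᵐ[μ] shift τ A) : σ = τ := by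
  have key : ∀ a > 0, μ.real (shift a A ∆ A) ≠ 0 := by
    intro a ha h0
    have hn : ∀ n : ℕ, μ.real (shift (n * a) A ∆ A) = 0 := by
      intro n
      induction n with
      | zero => simp [shift_zero]
      | succ n ih =>
        refine le_antisymm ?_ measureReal_nonneg
        have h1 := measureReal_symmDiff_le (μ := μ) (s := shift ((n + 1 : ℕ) * a) A)
          (t := shift a A) A
        rw [measureReal_shift_symmDiff_shift μ _ _ hA hA, h0] at h1
        have h2 : ((n + 1 : ℕ) : ℝ) * a - a = n * a := by push_cast; ring
        rwa [h2, ih, add_zero] at h1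
    refine hrec fun ε hε N => ?_
    obtain ⟨n, hN⟩ := exists_nat_gt (N / a)
    exact ⟨n * a, (div_lt_iff₀ ha).1 hN, by rwa [hn n]⟩
  have h0 : μ.real (shift (σ - τ) A ∆ A) = 0 := by
    rw [← measureReal_shift_symmDiff_shift μ _ _ hA hA, measureReal_eq_zero_iff,
      measure_symmDiff_eq_zero_iff]
    exact h
  rcases lt_trichotomy σ τ with hlt | heq | hgt
  · refine absurd ?_ (key (τ - σ) (by linarith))
    rw [← measureReal_symmDiff_shift_neg μ _ hA, neg_sub, h0]
  · exact heq
  · exact absurd h0 (key (σ - τ) (by linarith))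

/-- The orbit of a non-recurrent set is closed in the measure algebra. -/
theorem exists_shift_ae_eq_of_approx [MeasurableSpace.CountablyGenerated X]
    (hA : MeasurableSet A) (hrec : ¬ IsRecurrentSet μ A) {D : Set X}
    (hD : ∀ r > 0, ∃ τ : ℝ, μ.real (D ∆ shift τ A) < r) :
    ∃ τ : ℝ, D =ᵐ[μ] shift τ A := by
  unfold IsRecurrentSet at hrec
  push Not at hrec
  obtain ⟨ε, hε, N, hN⟩ := hrec
  set g : ℝ → ℝ := fun τ => μ.real (D ∆ shift τ A) with hg
  have hgle : ∀ σ τ, g τ ≤ g σ + μ.real (shift (τ - σ) A ∆ A) := by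
    intro σ τ
    rw [← measureReal_shift_symmDiff_shift μ _ _ hA hA, symmDiff_comm (shift τ A)]
    exact measureReal_symmDiff_le _
  have hcont : Continuous g := by
    rw [continuous_iff_continuousAt]
    intro σ
    have h1 : Tendsto (fun τ => μ.real (shift (τ - σ) A ∆ A)) (𝓝 σ) (𝓝 0) :=
      (tendsto_measureReal_shift_symmDiff μ hA).comp
        (by simpa using (tendsto_id (α := ℝ) (x := 𝓝 σ)).sub_const σ)
    refine tendsto_iff_dist_tendsto_zero.2 (squeeze_zero (fun _ => dist_nonneg) (fun τ => ?_) h1)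
    rw [Real.dist_eq, abs_le]
    have h2 := hgle σ τ
    have h3 := hgle τ σ
    rw [← neg_sub τ σ, measureReal_symmDiff_shift_neg μ _ hA] at h3
    constructor <;> linarith
  obtain ⟨τ₀, hτ₀⟩ := hD (ε / 2) (by positivity)
  -- Shifts of `A` by times more than `N` apart differ by at least `ε`, so good approximations come
  -- from a compact interval, where the continuous `g` attains its minimum.
  have hclose : ∀ τ, g τ < ε / 2 → |τ - τ₀| ≤ N := by
    intro τ hτ
    have h1 : μ.real (shift (τ - τ₀) A ∆ A) < ε := by
      rw [← measureReal_shift_symmDiff_shift μ _ _ hA hA]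
      have h2 := measureReal_symmDiff_le (μ := μ) (s := shift τ A) (t := D) (shift τ₀ A)
      rw [symmDiff_comm _ D] at h2
      have h3 : μ.real (D ∆ shift τ A) < ε / 2 := hτ
      linarith
    rw [abs_le]
    constructor
    · by_contra! hlt
      have h2 := hN (τ₀ - τ) (by linarith)
      rw [← neg_sub, measureReal_symmDiff_shift_neg μ _ hA] at h2
      linarith
    · by_contra! hlt
      linarith [hN _ hlt]
  obtain ⟨τ, -, hmin⟩ := (isCompact_Icc (a := τ₀ - N) (b := τ₀ + N)).exists_isMinOn
    ⟨τ₀, by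
      have := hclose τ₀ hτ₀
      rw [sub_self, abs_zero] at this
      constructor <;> linarith⟩ hcont.continuousOn
  refine ⟨τ, ?_⟩
  rw [← measure_symmDiff_eq_zero_iff, ← measureReal_eq_zero_iff]
  refine le_antisymm (le_of_forall_pos_lt_add fun r hr => ?_) measureReal_nonneg
  obtain ⟨σ, hσ⟩ := hD (min r (ε / 2)) (by positivity)
  have h1 := abs_le.1 (hclose σ (hσ.trans_le (min_le_right _ _)))
  have h2 : g τ ≤ g σ := hmin ⟨by linarith [h1.1], by linarith [h1.2]⟩
  rw [zero_add]
  exact h2.trans_lt (hσ.trans_le (min_le_left _ _))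

end NonRecurrent

/-- There is no equivariant real function on an ergodic flow whose measure is finite and non-zero,
or infinite and not of type I. -/
theorem false_of_ae_equivariant {Y : Type*} [MeasurableSpace Y] [StandardBorelSpace Y]
    [AddAction ℝ Y] [MeasurableVAdd₂ ℝ Y] (ν : Measure Y) [ErgodicVAdd ℝ Y ν] (hν0 : ν ≠ 0)
    (hν : IsFiniteMeasure ν ∨ ¬ IsTypeI ν) {s : Y → ℝ} (hs : Measurable s)
    (hst : ∀ᵐ y ∂ν, ∀ t : ℝ, s (t +ᵥ y) = t + s y) : False := by
  rcases hν with hfin | htype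
  · set ρ := ν.map s with hρ
    have hinv : ρ.IsAddLeftInvariant := by
      refine ⟨fun t => ?_⟩
      rw [hρ, Measure.map_map (measurable_const_add t) hs]
      have h1 : (fun y => t + y) ∘ s =ᵐ[ν] s ∘ fun y => t +ᵥ y := by
        filter_upwards [hst] with y hy using (hy t).symm
      rw [Measure.map_congr h1, ← Measure.map_map hs (measurable_const_vadd t),
        (measurePreserving_vadd t ν).map_eq]
    have hρ0 : ρ ≠ 0 := (Measure.map_ne_zero_iff hs.aemeasurable).2 hν0
    have : NeZero ρ := ⟨hρ0⟩
    have : ρ.IsOpenPosMeasure := isOpenPosMeasure_of_addLeftInvariant_of_regular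
    exact measure_ne_top ρ univ (measure_univ_of_isAddLeftInvariant ρ)
  -- Sliding each point back along its orbit by time `s y` gives an invariant map, constant almost
  -- everywhere by ergodicity; `ν` then sits on the orbit of that constant.
  · set π : Y → Y := fun y => (-s y) +ᵥ y with hπ
    have hπm : Measurable π := hs.neg.vadd measurable_id
    have hinv : ∀ U, MeasurableSet U → (∀ᵐ y ∂ν, π y ∈ U) ∨ (∀ᵐ y ∂ν, π y ∉ U) := by
      intro U hU
      refine eventuallyConst_set.1 (ErgodicVAdd.aeconst_of_forall_preimage_vadd_ae_eq (G := ℝ)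
        (s := π ⁻¹' U) (hπm hU) fun t => ?_)
      filter_upwards [hst] with y hy
      have h : π (t +ᵥ y) = π y := by
        simp only [hπ, hy t, vadd_vadd]
        congr 1
        ring
      change (π (t +ᵥ y) ∈ U) = (π y ∈ U)
      rw [h]
    have : NeZero ν := ⟨hν0⟩
    have : Nonempty Y := ν.nonempty_of_neZero
    obtain ⟨a, ha⟩ := exists_eventuallyEq_const_of_forall_separating MeasurableSet hinv
    refine htype ⟨a, ?_⟩
    rw [← mem_ae_iff]
    filter_upwards [ha] with y hy
    refine ⟨s y, ?_⟩
    have h : (-s y) +ᵥ y = a := hy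
    change s y +ᵥ a = y
    rw [← h, vadd_vadd]
    simp

/-- An equivariant measurable family of sets over an ergodic flow, whose measure is finite and
non-zero, or infinite and not of type I, contains recurrent sets. -/
theorem exists_isRecurrentSet_of_equivariant {X Y : Type*} [MeasurableSpace X]
    [MeasurableSpace.CountablyGenerated X] [AddAction ℝ X] [MeasurableVAdd₂ ℝ X]
    (μ : Measure X) [IsFiniteMeasure μ] [VAddInvariantMeasure ℝ X μ]
    [MeasurableSpace Y] [StandardBorelSpace Y] [AddAction ℝ Y] [MeasurableVAdd₂ ℝ Y]
    (ν : Measure Y) [ErgodicVAdd ℝ Y ν] (hν0 : ν ≠ 0)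
    (hν : IsFiniteMeasure ν ∨ ¬ IsTypeI ν) {A : Y → Set X}
    (hA : MeasurableSet {p : Y × X | p.2 ∈ A p.1})
    (hAt : ∀ (t : ℝ) (y : Y), A (t +ᵥ y) = shift (-t) (A y)) :
    ¬ ∀ᵐ y ∂ν, ¬ IsRecurrentSet μ (A y) := by
  intro hrec
  obtain ⟨E, hE, hd⟩ := exists_countable_dense_sets μ
  have hAm : ∀ y, MeasurableSet (A y) := fun y => measurable_prodMk_left hA
  have hdm : ∀ n, Measurable fun y => μ.real (A y ∆ E n) := by
    intro n
    have h : MeasurableSet ({p : Y × X | p.2 ∈ A p.1} ∆ (Prod.snd ⁻¹' E n)) :=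
      hA.symmDiff (measurable_snd (hE n))
    exact (measurable_measure_prodMk_left (ν := μ) h).ennreal_toReal
  -- By ergodicity almost all `y` agree on which balls around the `E n` their fibres visit for
  -- positive time, so their fibre orbits have the same closure. Asking for positive time, not a
  -- mere visit, makes the condition measurable in `y` by Fubini.
  set T : ℕ → ℕ → Y → Set ℝ := fun n k y =>
    {t | μ.real (A (t +ᵥ y) ∆ E n) < 1 / ((k : ℝ) + 1)} with hT
  set V : ℕ → ℕ → Set Y := fun n k => {y | volume (T n k y) = 0} with hV
  have hVconst : ∀ n k, EventuallyConst (V n k) (ae ν) := by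
    intro n k
    have hm : MeasurableSet {p : Y × ℝ | μ.real (A (p.2 +ᵥ p.1) ∆ E n) < 1 / ((k : ℝ) + 1)} :=
      ((hdm n).comp (measurable_snd.vadd measurable_fst)) measurableSet_Iio
    refine ErgodicVAdd.aeconst_of_forall_preimage_vadd_ae_eq (G := ℝ)
      (measurable_measure_prodMk_left (ν := (volume : Measure ℝ)) hm (measurableSet_singleton 0))
      fun s => .of_eq ?_
    ext y
    have h : T n k (s +ᵥ y) = (fun t => t + s) ⁻¹' T n k y := by
      ext t
      simp [hT, add_vadd]
    change volume (T n k (s +ᵥ y)) = 0 ↔ volume (T n k y) = 0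
    rw [h, measure_preimage_add_right]
  have hVae : ∀ᵐ y ∂ν, ∀ n k, (y ∈ V n k ↔ ∀ᵐ z ∂ν, z ∈ V n k) := by
    rw [ae_all_iff]
    intro n
    rw [ae_all_iff]
    intro k
    have : NeZero ν := ⟨hν0⟩
    rcases eventuallyConst_set.1 (hVconst n k) with h | h
    · filter_upwards [h] with y hy using iff_of_true hy h
    · filter_upwards [h] with y hy
      refine iff_of_false hy fun h' => ?_
      obtain ⟨z, hz, hz'⟩ := (h.and h').exists
      exact hz hz'
  have : NeZero ν := ⟨hν0⟩
  obtain ⟨y₀, hy₀rec, hy₀⟩ := (hrec.and hVae).exists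
  have horbit : ∀ᵐ y ∂ν, ∃ τ : ℝ, A y =ᵐ[μ] A (τ +ᵥ y₀) := by
    filter_upwards [hVae] with y hy
    suffices h : ∃ τ : ℝ, A y =ᵐ[μ] shift τ (A y₀) by
      obtain ⟨τ, hτ⟩ := h
      exact ⟨-τ, by rwa [hAt, neg_neg]⟩
    refine exists_shift_ae_eq_of_approx (hAm y₀) hy₀rec fun r hr => ?_
    obtain ⟨k, hk⟩ := exists_nat_one_div_lt (half_pos hr)
    obtain ⟨n, hn⟩ : ∃ n, volume (T n k y) ≠ 0 := by
      by_contra! hcon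
      have h1 : volume (⋃ n, T n k y) = 0 := measure_iUnion_null hcon
      have h2 : ⋃ n, T n k y = univ :=
        eq_univ_of_forall fun t => mem_iUnion.2 (hd _ (hAm _) _ (by positivity))
      rw [h2] at h1
      simp at h1
    have hn₀ : volume (T n k y₀) ≠ 0 := fun h => hn ((hy n k).2 ((hy₀ n k).1 h))
    obtain ⟨t, ht⟩ := nonempty_of_measure_ne_zero hn
    obtain ⟨t', ht'⟩ := nonempty_of_measure_ne_zero hn₀
    refine ⟨t - t', ?_⟩
    have h1 := measureReal_symmDiff_le (μ := μ) (s := A (t +ᵥ y)) (t := E n) (A (t' +ᵥ y₀))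
    have h2 : μ.real (A (t +ᵥ y) ∆ E n) < 1 / ((k : ℝ) + 1) := ht
    have h3 : μ.real (A (t' +ᵥ y₀) ∆ E n) < 1 / ((k : ℝ) + 1) := ht'
    have h4 : μ.real (A y ∆ shift (t - t') (A y₀)) = μ.real (A (t +ᵥ y) ∆ A (t' +ᵥ y₀)) := by
      rw [hAt, hAt, symmDiff_comm, symmDiff_comm (shift (-t) _),
        measureReal_shift_symmDiff_shift μ _ _ (hAm _) (hAm _)]
      congr 3
      ring
    rw [symmDiff_comm (E n)] at h1
    linarith
  -- Distances to a dense sequence determine `A y` modulo null sets.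
  set enc : Y → ℕ → ℝ := fun y n => μ.real (A y ∆ E n) with henc
  have hencm : Measurable enc := measurable_pi_iff.2 hdm
  have henc_ae : ∀ {y y'}, enc y = enc y' → A y =ᵐ[μ] A y' := by
    intro y y' h
    rw [← measure_symmDiff_eq_zero_iff, ← measureReal_eq_zero_iff]
    refine le_antisymm (le_of_forall_pos_lt_add fun r hr => ?_) measureReal_nonneg
    obtain ⟨n, hn⟩ := hd (A y) (hAm y) (r / 2) (by positivity)
    have h1 := measureReal_symmDiff_le (μ := μ) (s := A y) (t := E n) (A y')
    have h2 : μ.real (A y ∆ E n) = μ.real (A y' ∆ E n) := congrFun h n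
    rw [symmDiff_comm (E n), ← h2] at h1
    linarith
  have hae_enc : ∀ {y y'}, A y =ᵐ[μ] A y' → enc y = enc y' := fun h =>
    funext fun n => measureReal_congr (h.symmDiff (ae_eq_refl _))
  -- Lusin–Souslin: an injective Borel map has a Borel inverse on its image, which reads off the
  -- time parameter of a fibre.
  have hψ : MeasurableEmbedding fun t : ℝ => enc (t +ᵥ y₀) := by
    refine (hencm.comp (measurable_id.vadd_const y₀)).measurableEmbedding fun σ τ h => ?_
    have h1 := henc_ae h
    rw [hAt, hAt] at h1
    exact neg_injective (eq_of_shift_ae_eq_shift (hAm y₀) hy₀rec h1)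
  obtain ⟨g, hgm, hg⟩ := hψ.exists_measurable_extend measurable_id fun _ => inferInstance
  refine false_of_ae_equivariant ν hν0 hν (hgm.comp hencm) ?_
  filter_upwards [horbit] with y ⟨τ, hτ⟩ t
  have h1 : enc y = enc (τ +ᵥ y₀) := hae_enc hτ
  have h2 : enc (t +ᵥ y) = enc ((t + τ) +ᵥ y₀) := by
    refine hae_enc ?_
    rw [add_vadd, hAt, hAt t]
    exact (measurePreserving_vadd (-t) μ).quasiMeasurePreserving.preimage_ae_eq hτ
  have h3 : ∀ t, g (enc (t +ᵥ y₀)) = t := fun t => congrFun hg t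
  rw [Function.comp_apply, Function.comp_apply, h1, h2, h3, h3]

end ErgodicFlow

/-! ### Ergodicity of the product flow -/

theorem mainTheorem7 {X : Type u} [mX : MeasurableSpace X] [StandardBorelSpace X]
    [AddAction ℝ X] [MeasurableVAdd₂ ℝ X]
    (μ : Measure X) [IsProbabilityMeasure μ] [ErgodicVAdd ℝ X μ]
    (hfin : ∀ m : MeasurableSpace X, ErgodicFlow.IsFactor m mX → ErgodicFlow.IsNontrivial m μ →
      ErgodicFlow.IsFiniteExtension m μ)
    (hrigid : ¬ ErgodicFlow.IsPartiallyRigid μ) :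
    ErgodicFlow.IsMildlyMixing.{u, v} μ := by
  intro Y _ _ _ _ ν _ _ hν
  have hpres : ∀ t : ℝ, MeasurePreserving (fun p : X × Y => t +ᵥ p) (μ.prod ν) (μ.prod ν) :=
    fun t => (measurePreserving_vadd t μ).prod (measurePreserving_vadd t ν)
  have : MeasurableVAdd₂ ℝ (X × Y) := ⟨by
    exact (measurable_fst.vadd (measurable_fst.comp measurable_snd)).prodMk
      (measurable_fst.vadd (measurable_snd.comp measurable_snd))⟩
  refine { measure_preimage_vadd := fun t s hs => (hpres t).measure_preimage hs.nullMeasurableSet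
           aeconst_of_forall_preimage_vadd_ae_eq := fun {B} hB hinv => ?_ }
  obtain ⟨B', hB'm, hB'inv, hB'ae⟩ :=
    ErgodicFlow.exists_strictly_invariant_ae_eq (μ.prod ν) hB hinv
  refine EventuallyConst.congr ?_ hB'ae
  set A : Y → Set X := fun y => {x | (x, y) ∈ B'} with hA
  have hAprod : MeasurableSet {p : Y × X | p.2 ∈ A p.1} := measurable_swap hB'm
  have hAm : ∀ y, MeasurableSet (A y) := fun y => measurable_prodMk_right hB'm
  have hAt : ∀ (t : ℝ) (y : Y), A (t +ᵥ y) = ErgodicFlow.shift (-t) (A y) := by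
    intro t y
    ext x
    change (x, t +ᵥ y) ∈ B' ↔ (-t +ᵥ x, y) ∈ B'
    conv_lhs => rw [← hB'inv (-t)]
    change (-t +ᵥ x, -t +ᵥ t +ᵥ y) ∈ B' ↔ _
    rw [neg_vadd_vadd]
  have hconst : ∀ A' : Y → Set X, MeasurableSet {p : Y × X | p.2 ∈ A' p.1} →
      (∀ (t : ℝ) (y : Y), A' (t +ᵥ y) = ErgodicFlow.shift (-t) (A' y)) →
      (∀ᵐ y ∂ν, μ (A' y) = 0) ∨ (∀ᵐ y ∂ν, μ (A' y) ≠ 0) := by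
    intro A' hA'm hA't
    have hm : MeasurableSet {y | μ (A' y) = 0} :=
      measurable_measure_prodMk_left (ν := μ) hA'm (measurableSet_singleton 0)
    refine eventuallyConst_set.1 (ErgodicVAdd.aeconst_of_forall_preimage_vadd_ae_eq (G := ℝ)
      hm fun t => .of_eq ?_)
    ext y
    change μ (A' (t +ᵥ y)) = 0 ↔ μ (A' y) = 0
    have hA'y : MeasurableSet (A' y) := measurable_prodMk_left hA'm
    rw [hA't, ErgodicFlow.measure_shift μ _ hA'y]
  have hnull : ∀ S : Set (X × Y), MeasurableSet S → (∀ᵐ y ∂ν, μ {x | (x, y) ∈ S} = 0) →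
      μ.prod ν S = 0 := by
    intro S hS h
    rw [Measure.prod_apply_symm hS]
    exact (lintegral_congr_ae h).trans lintegral_zero
  rw [eventuallyConst_set']
  rcases hconst A hAprod hAt with h0 | h0
  · left
    exact ae_eq_empty.2 (hnull _ hB'm h0)
  rcases hconst (fun y => (A y)ᶜ) hAprod.compl
    (fun t y => by rw [hAt]; rfl) with h1 | h1
  · right
    exact ae_eq_univ.2 (hnull _ hB'm.compl h1)
  -- This case is contradictory. Either alternative could be chosen; denying the null one also
  -- yields `ν ≠ 0`.
  · left
    by_contra hne
    have hν0 : ν ≠ 0 := by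
      rintro rfl
      refine hne ?_
      rw [Measure.prod_zero, ae_zero]
      exact eventually_bot
    refine ErgodicFlow.exists_isRecurrentSet_of_equivariant μ ν hν0 hν hAprod hAt ?_
    filter_upwards [h0, h1] with y hy0 hy1 hrec
    exact hrigid (ErgodicFlow.isPartiallyRigid_of_isRecurrentSet μ hfin (hAm y) hy0 hy1 hrec)
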